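/- Let $(A,\mathfrak m)$ be a one-dimensional Cohen–Macaulay (Noetherian) local ring, let $M$ be a maximal Cohen–Macaulay $A$-module, i.e. a finitely generated $A$-module with $\operatorname{depth} M=\dim M=\dim A$, and let $I$ be an $\mathfrak m$-primary ideal of $A$. Then $$\operatorname{rt}(I;M)\le e(A).$$ Here $e(A)=\lim_{n\to\infty}(\dim A)!\,\ell_A(A/\mathfrak m^n)/n^{\dim A}$ is the multiplicity of $A$. The relation type $\operatorname{rt}(I;M)$ of $I$ with respect to $M$ is defined as follows. Let $\mathbf S(I)=\bigoplus_{n\ge 0}\mathbf S_n(I)$ be the symmetric algebra of the $A$-module $I$, let $\mathcal R(I)=\bigoplus_{n\ge0}I^nt^n$ be the Rees algebra of $I$ and $\mathcal R(I;M)=\bigoplus_{n\ge0}I^nM$ the Rees module, and let $\gamma:\mathbf S(I)\otimes_A M\to\mathcal R(I)\otimes_A M\to\mathcal R(I;M)$ be the canonical graded epimorphism, with components $\gamma_n:\mathbf S_n(I)\otimes_A M\to I^nM$. The module of effective $n$-relations is $E(I;M)_n=\ker\gamma_n/(I\cdot\ker\gamma_{n-1})$ for $n\ge1$, where $I=\mathbf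 S_1(I)$ acts by multiplication in $\mathbf S(I)$. Then $\operatorname{rt}(I;M)$ is the least integer $r\ge1$ such that $E(I;M)_n=0$ for all $n\ge r+1$ (and $\infty$ if there is none). -/

import Mathlib

open scoped TensorProduct

noncomputable section

/-! ### Relation type of an ideal with respect to a module -/

namespace RelationType

universe u v

variable {A : Type u} [CommRing A] (I : Ideal A) (M : Type v) [AddCommGroup M] [Module A M]

/-- The inclusion of `I`, as the degree one part `I t`, into the Rees algebra
`R(I) = ⨁ Iⁿ tⁿ ⊆ A[t]`. -/
def reesDegreeOne : I →ₗ[A] reesAlgebra I :=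
  LinearMap.codRestrict (Subalgebra.toSubmodule (reesAlgebra I))
    ((Polynomial.monomial 1 : A →ₗ[A] Polynomial A) ∘ₗ I.subtype)
    (fun x => reesAlgebra.monomial_mem.2 (by simp))

/-- The canonical graded morphism `α : S(I) → R(I)` from the symmetric algebra of the `A`-module
`I` onto the Rees algebra of `I`, induced by the identity in degree one. -/
def symToRees : SymmetricAlgebra A I →ₐ[A] reesAlgebra I :=
  SymmetricAlgebra.lift (reesDegreeOne I)

/-- The Rees module `R(I; M) = ⨁ Iⁿ M`, as the `R(I)`-submodule of `M[t]` of all `f` whose `n`-th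
coefficient lies in `Iⁿ M` for every `n`. -/
abbrev reesModule : Submodule (reesAlgebra I) (PolynomialModule A M) :=
  (I.stableFiltration (⊤ : Submodule A M)).submodule

/-- The identification of `M` with the degree zero part of `R(I; M)`. -/
def reesModuleDegreeZero : M →ₗ[A] reesModule I M where
  toFun m := ⟨PolynomialModule.single A 0 m, fun i => by
    rw [PolynomialModule.coeff_single, Finsupp.single_apply]
    split_ifs with h
    · subst h
      simp [Ideal.stableFiltration]
    · exact Submodule.zero_mem _⟩
  map_add' x y := Subtype.ext (map_add (PolynomialModule.lsingle A 0) x y)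
  map_smul' a x := Subtype.ext (map_smul (PolynomialModule.lsingle A 0) a x)

/-- The structural morphism `R(I) ⊗ M → R(I; M)`, `r ⊗ m ↦ r m`. -/
def reesStructural : reesAlgebra I ⊗[A] M →ₗ[A] reesModule I M :=
  TensorProduct.lift
    (LinearMap.mk₂ A (fun (r : reesAlgebra I) (m : M) => r • reesModuleDegreeZero I M m)
      (fun _ _ _ => add_smul _ _ _) (fun _ _ _ => smul_assoc _ _ _)
      (fun _ _ _ => by rw [map_add, smul_add])
      (fun _ _ _ => by rw [map_smul, smul_comm]))

/-- The canonical symmetric presentation `γ : S(I) ⊗ M → R(I) ⊗ M → R(I; M)`. -/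
def symPresentation : SymmetricAlgebra A I ⊗[A] M →ₗ[A] reesModule I M :=
  reesStructural I M ∘ₗ TensorProduct.map (symToRees I).toLinearMap LinearMap.id

/-- The `n`-th graded piece `Sₙ(I)` of the symmetric algebra: the submodule spanned by all products
of `n` elements of `I`. -/
def symDegree (n : ℕ) : Submodule A (SymmetricAlgebra A I) :=
  LinearMap.range (SymmetricAlgebra.ι A I) ^ n

/-- The `n`-th graded piece `Sₙ(I) ⊗ M` of `S(I) ⊗ M`, with `M` in degree zero. -/
def symTensorDegree (n : ℕ) : Submodule A (SymmetricAlgebra A I ⊗[A] M) :=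
  LinearMap.range (TensorProduct.map (symDegree I n).subtype (LinearMap.id : M →ₗ[A] M))

/-- The `n`-th graded piece `ker γₙ` of the kernel of `γ`. -/
def relations (n : ℕ) : Submodule A (SymmetricAlgebra A I ⊗[A] M) :=
  symTensorDegree I M n ⊓ LinearMap.ker (symPresentation I M)

/-- The submodule `S₁(I) · ker γₙ₋₁` of `ker γₙ`, for `n ≥ 1` (and `0` for `n = 0`): the relations
of degree `n` that come from relations of degree `n - 1`. -/
def inducedRelations : ℕ → Submodule A (SymmetricAlgebra A I ⊗[A] M)
  | 0 => ⊥
  | n + 1 => Submodule.span A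
      {w | ∃ x : I, ∃ z ∈ relations I M n, w = SymmetricAlgebra.ι A I x • z}

instance (n : ℕ) : AddCommGroup (relations I M n) := Submodule.addCommGroup _

/-- The module of effective `n`-relations `E(I; M)ₙ = ker γₙ / S₁(I) ker γₙ₋₁`. (In degree `0` this
is `ker γ₀ = 0`.) -/
abbrev EffectiveRelations (n : ℕ) : Type _ :=
  relations I M n ⧸ (inducedRelations I M n).submoduleOf (relations I M n)

end RelationType

/-- The relation type `rt(I; M)`: the least `r ≥ 1` (possibly infinite) such that the module of
effective `n`-relations of `I` with respect to `M` vanishes for all `n ≥ r + 1`. -/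
def relationType {A : Type*} [CommRing A] (I : Ideal A) (M : Type*) [AddCommGroup M] [Module A M] :
    ℕ∞ :=
  sInf {r : ℕ∞ | 1 ≤ r ∧ ∀ n : ℕ, r < n → Subsingleton (RelationType.EffectiveRelations I M n)}

/-! ### Cohen–Macaulay modules over local rings, multiplicity -/

/-- The depth of a module over a local ring: the supremum of the lengths of the `M`-regular
sequences in the maximal ideal. -/
def localDepth (A : Type*) [CommRing A] [IsLocalRing A] (M : Type*) [AddCommGroup M] [Module A M] :
    ℕ∞ :=
  ⨆ rs : {rs : List A //
    (∀ r ∈ rs, r ∈ IsLocalRing.maximalIdeal A) ∧ RingTheory.Sequence.IsRegular M rs},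
    (rs.1.length : ℕ∞)

/-- A Cohen–Macaulay module over a Noetherian local ring: a finitely generated module which is zero
or has depth equal to its Krull dimension (the dimension of its support). -/
def IsCohenMacaulayModule (A : Type*) [CommRing A] [IsLocalRing A] (M : Type*) [AddCommGroup M]
    [Module A M] : Prop :=
  Module.Finite A M ∧
    (Subsingleton M ∨ (localDepth A M : WithBot ℕ∞) = Module.supportDim A M)

/-- A Cohen–Macaulay local ring: a Noetherian local ring that is Cohen–Macaulay as a module over
itself. -/
def IsCohenMacaulayLocalRing (A : Type*) [CommRing A] [IsLocalRing A] : Prop :=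
  IsNoetherianRing A ∧ IsCohenMacaulayModule A A

/-- A maximal Cohen–Macaulay module: a Cohen–Macaulay module `M` with `dim M = dim A`. -/
def IsMaximalCohenMacaulayModule (A : Type*) [CommRing A] [IsLocalRing A] (M : Type*)
    [AddCommGroup M] [Module A M] : Prop :=
  IsCohenMacaulayModule A M ∧ Module.supportDim A M = ringKrullDim A

/-- The dimension of `A` as a natural number (for a Noetherian local ring it is finite). -/
def natKrullDim (A : Type*) [CommRing A] : ℕ := ((ringKrullDim A).unbotD 0).toNat

/-- The Hilbert–Samuel multiplicity `e(A) = lim d! · length(A / 𝔪ⁿ) / nᵈ`, with `d = dim A`, of a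
Noetherian local ring. It is written as an upper limit in `[0, ∞]`, which agrees with the limit
whenever the latter exists. -/
def localMultiplicity (A : Type*) [CommRing A] [IsLocalRing A] : ENNReal :=
  Filter.limsup (fun n : ℕ =>
    ((natKrullDim A).factorial : ENNReal) *
      ((Module.length A (A ⧸ IsLocalRing.maximalIdeal A ^ n) : ℕ∞) : ENNReal) /
        (n : ENNReal) ^ natKrullDim A) Filter.atTop

end

/-! ### Polynomial families of linear maps and the Eakin–Sathaye theorem over a field -/

section Field

variable {k : Type*} [Field k]

/-! The bound comes from reduction numbers. Suppose that `I ^ (r + 1) = y I ^ r` holds after a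
faithfully flat base change `A → B`, with `y ∈ I B`, and that `I` contains an `M`-regular element,
so that `y` is regular on `B ⊗ M`. In a relation `∑ x_k g_k = 0` with `g_k ∈ I ^ (p + 1) M` and `p ≥
r`, write `g_k = y u_k`. Cancelling `y` gives `∑ x_k u_k = 0`, and the original relation is `y`
times this one. Hence there are no effective relations in degree `p + 2`, and `rt(I; M) ≤ r + 1`
(`relations_le_inducedRelations`).

It remains to find such an `r` with `r + 1 ≤ e(A)`. Take `B = A(X)`, which has infinite residue
field and preserves lengths. For a nonzerodivisor `x` in the maximal ideal, an ideal of finite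
colength has at most `ℓ(B/x)` generators; if `ℓ(B/x) = r + 1`, the Eakin–Sathaye theorem gives every
finitely generated ideal containing a power of a nonzerodivisor of finite colength a principal
reduction with reduction number at most `r`.

This is used twice in `exists_reductionNumber_lt_multiplicity`. An arbitrary `x` yields a reduction
`y` of the maximal ideal. Growth of `ℓ(A/𝔪ⁿ)` shows `ℓ(B/y) ≤ e(A)`, and `y` in the role of `x` then
gives the sharp bound for `I B`. -/

/-- Surjectivity is an open condition in a polynomial family of linear maps. -/
theorem finite_setOf_not_surjective_sum_pow_smul {V W : Type*} [AddCommGroup V] [Module k V]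
    [AddCommGroup W] [Module k W] [FiniteDimensional k W] {d : ℕ} (φ : Fin d → V →ₗ[k] W) (t₀ : k)
    (h : Function.Surjective (∑ i : Fin d, t₀ ^ (i : ℕ) • φ i : V →ₗ[k] W)) :
    {t : k | ¬ Function.Surjective (∑ i : Fin d, t ^ (i : ℕ) • φ i : V →ₗ[k] W)}.Finite := by
  -- Composing with a section at `t₀` gives endomorphisms of `W` whose determinant is a polynomial
  -- in `t` with value `1` at `t₀`; surjectivity can fail only at its roots.
  obtain ⟨σ, hσ⟩ := LinearMap.exists_rightInverse_of_surjective _ (LinearMap.range_eq_top.2 h)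
  let b := Module.finBasis k W
  let P : Polynomial k := Matrix.det
    (∑ i : Fin d, (Polynomial.X ^ (i : ℕ) : Polynomial k) •
      (LinearMap.toMatrix b b (φ i ∘ₗ σ)).map Polynomial.C)
  have hP (t : k) : P.eval t = LinearMap.det ((∑ i : Fin d, t ^ (i : ℕ) • φ i) ∘ₗ σ) := by
    rw [← LinearMap.det_toMatrix b, ← Polynomial.coe_evalRingHom, RingHom.map_det]
    congr 1
    ext a c
    simp [Matrix.sum_apply, LinearMap.toMatrix_apply]
    exact Finset.sum_congr rfl fun _ _ => mul_comm _ _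
  have hP0 : P ≠ 0 := fun h0 => by
    have := hP t₀
    rw [hσ, h0] at this
    simp at this
  classical
  refine (P.roots.toFinset.finite_toSet).subset fun t ht => ?_
  simp only [Finset.mem_coe, Multiset.mem_toFinset, Polynomial.mem_roots hP0]
  by_contra hne
  refine ht ?_
  have hu : IsUnit (LinearMap.det ((∑ i : Fin d, t ^ (i : ℕ) • φ i) ∘ₗ σ)) := by
    rw [← hP]; exact isUnit_iff_ne_zero.2 hne
  have hs := ((LinearMap.equivOfDetNeZero _ hu.ne_zero).surjective)
  intro w
  obtain ⟨v, hv⟩ := hs w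
  exact ⟨σ v, hv⟩

theorem finite_setOf_not_le_range_sum_pow_smul {V F : Type*} [AddCommGroup V] [Module k V]
    [AddCommGroup F] [Module k F] {d : ℕ} (φ : Fin d → V →ₗ[k] F) (W : Submodule k F)
    [FiniteDimensional k W] (hφ : ∀ i v, φ i v ∈ W) (t₀ : k)
    (h : W ≤ LinearMap.range (∑ i : Fin d, t₀ ^ (i : ℕ) • φ i)) :
    {t : k | ¬ W ≤ LinearMap.range (∑ i : Fin d, t ^ (i : ℕ) • φ i)}.Finite := by
  let ψ : Fin d → V →ₗ[k] W := fun i => (φ i).codRestrict W (hφ i)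
  have key (t : k) : Function.Surjective (∑ i : Fin d, t ^ (i : ℕ) • ψ i : V →ₗ[k] W) ↔
      W ≤ LinearMap.range (∑ i : Fin d, t ^ (i : ℕ) • φ i) := by
    have hc (v : V) : (((∑ i : Fin d, t ^ (i : ℕ) • ψ i) v : W) : F) = (∑ i : Fin d, t ^ (i : ℕ) • φ i) v := by
      simp [ψ, LinearMap.sum_apply]
    constructor
    · intro hs w hw
      obtain ⟨v, hv⟩ := hs ⟨w, hw⟩
      exact ⟨v, by rw [← hc, hv]⟩
    · rintro hs ⟨w, hw⟩
      obtain ⟨v, hv⟩ := hs hw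
      exact ⟨v, Subtype.ext (by rw [hc, hv])⟩
  simp only [← key] at h ⊢
  exact finite_setOf_not_surjective_sum_pow_smul ψ t₀ h

/-- The Vandermonde matrix of `d` distinct nodes is invertible, so `d` points of the curve already
recover all the `l i`. -/
theorem mem_span_range_sum_pow_smul {F : Type*} [AddCommGroup F] [Module k F] {d : ℕ}
    (l : Fin d → F) (e : Fin d ↪ k) (i : Fin d) :
    l i ∈ Submodule.span k (Set.range fun j => ∑ m : Fin d, e j ^ (m : ℕ) • l m) := by
  have hdet : IsUnit (Matrix.vandermonde e).det :=
    isUnit_iff_ne_zero.2 (Matrix.det_vandermonde_ne_zero_iff.2 e.injective)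
  have : l i = ∑ j, (Matrix.vandermonde e)⁻¹ i j • ∑ m : Fin d, e j ^ (m : ℕ) • l m := by
    simp only [Finset.smul_sum, smul_smul]
    rw [Finset.sum_comm]
    simp only [← Finset.sum_smul]
    have h (m : Fin d) : ∑ j, (Matrix.vandermonde e)⁻¹ i j * e j ^ (m : ℕ) =
        (1 : Matrix (Fin d) (Fin d) k) i m := by
      rw [← Matrix.nonsing_inv_mul _ hdet, Matrix.mul_apply]
      rfl
    simp [h, Matrix.one_apply]
  rw [this]
  exact Submodule.sum_mem _ fun j _ => Submodule.smul_mem _ _ (Submodule.subset_span ⟨j, rfl⟩)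

/-- Since `d` points of the curve span `L`, an inclusion for all of `a L ^ (n + 1)` can be checked
on the products of those points with `L ^ n`. -/
theorem Submodule.map_mulLeft_pow_succ_le {F : Type*} [CommRing F] [Algebra k F] {d : ℕ}
    (l : Fin d → F)
    (a y : F) (n : ℕ) (t : Fin d ↪ k)
    (h : ∀ j, ((Submodule.span k (Set.range l)) ^ n).map
        (LinearMap.mulLeft k (a * ∑ i : Fin d, t j ^ (i : ℕ) • l i)) ≤
      ((Submodule.span k (Set.range l)) ^ n).map (LinearMap.mulLeft k (a * y))) :
    ((Submodule.span k (Set.range l)) ^ (n + 1)).map (LinearMap.mulLeft k a) ≤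
      ((Submodule.span k (Set.range l)) ^ n).map (LinearMap.mulLeft k (a * y)) := by
  set L := Submodule.span k (Set.range l) with hL
  rw [Submodule.map_le_iff_le_comap, pow_succ', Submodule.mul_le]
  intro u hu w hw
  have hL' : L ≤ Submodule.span k (Set.range fun j => ∑ m : Fin d, t j ^ (m : ℕ) • l m) :=
    Submodule.span_le.2 (by rintro _ ⟨i, rfl⟩; exact mem_span_range_sum_pow_smul l t i)
  have hu' := hL' hu
  clear hu
  induction hu' using Submodule.span_induction with
  | mem x hx =>
    obtain ⟨j, rfl⟩ := hx
    refine h j ⟨w, hw, ?_⟩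
    simp
  | zero => simp
  | add x y _ _ hx hy => rw [add_mul]; exact add_mem hx hy
  | smul c x _ hx => rw [smul_mul_assoc]; exact Submodule.smul_mem _ _ hx

/-- The Eakin–Sathaye theorem for one general element, in a commutative algebra over an infinite
field: if `dim (a Lⁿ⁺¹) ≤ n + 1`, then `a Lⁿ⁺¹ = y a Lⁿ` for almost every `y` on a curve spanning
`L`. -/
theorem finite_setOf_not_map_mulLeft_pow_succ_le [Infinite k] {F : Type*} [CommRing F] [Algebra k F]
    {d : ℕ} (l : Fin d → F) (n : ℕ) (a : F)
    (h : Module.finrank k (((Submodule.span k (Set.range l)) ^ (n + 1)).map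
      (LinearMap.mulLeft k a)) ≤ n + 1) :
    {t : k | ¬ ((Submodule.span k (Set.range l)) ^ (n + 1)).map (LinearMap.mulLeft k a) ≤
      ((Submodule.span k (Set.range l)) ^ n).map
        (LinearMap.mulLeft k (a * ∑ i : Fin d, t ^ (i : ℕ) • l i))}.Finite := by
  set L := Submodule.span k (Set.range l) with hL
  set y : k → F := fun t => ∑ i : Fin d, t ^ (i : ℕ) • l i with hy
  have hyL (t : k) : y t ∈ L := Submodule.sum_mem _ fun i _ =>
    Submodule.smul_mem _ _ (Submodule.subset_span ⟨i, rfl⟩)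
  have hLfg : L.FG := Submodule.fg_span (Set.finite_range l)
  have hfd (m : ℕ) (c : F) : FiniteDimensional k ((L ^ m).map (LinearMap.mulLeft k c)) :=
    Module.Finite.iff_fg.2 ((hLfg.pow m).map _)
  have hle (m : ℕ) (c : F) (t : k) : (L ^ m).map (LinearMap.mulLeft k (c * y t)) ≤
      (L ^ (m + 1)).map (LinearMap.mulLeft k c) := by
    rintro _ ⟨w, hw, rfl⟩
    refine ⟨y t * w, ?_, by simp⟩
    rw [pow_succ']
    exact Submodule.mul_mem_mul (hyL t) hw
  change {t : k | ¬ (L ^ (n + 1)).map (LinearMap.mulLeft k a) ≤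
    (L ^ n).map (LinearMap.mulLeft k (a * y t))}.Finite
  -- If one parameter works, openness of surjectivity finishes. Otherwise every `a y(t) Lⁿ` is a
  -- proper subspace of `a Lⁿ⁺¹`, so its dimension drops to at most `n` and induction applies with
  -- `a` replaced by `a y(e j)`.
  by_cases hex : ∃ t₀, (L ^ (n + 1)).map (LinearMap.mulLeft k a) ≤
      (L ^ n).map (LinearMap.mulLeft k (a * y t₀))
  · obtain ⟨t₀, ht₀⟩ := hex
    let φ : Fin d → (L ^ n : Submodule k F) →ₗ[k] F := fun i =>
      LinearMap.mulLeft k (a * l i) ∘ₗ (L ^ n).subtype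
    have hφ (t : k) : LinearMap.range (∑ i : Fin d, t ^ (i : ℕ) • φ i) =
        (L ^ n).map (LinearMap.mulLeft k (a * y t)) := by
      have : (∑ i : Fin d, t ^ (i : ℕ) • φ i) = LinearMap.mulLeft k (a * y t) ∘ₗ (L ^ n).subtype := by
        ext v
        simp [φ, hy, LinearMap.sum_apply, Finset.mul_sum, Finset.sum_mul, mul_assoc]
      rw [this, LinearMap.range_comp, Submodule.range_subtype]
    have := hfd (n + 1) a
    have key := finite_setOf_not_le_range_sum_pow_smul φ ((L ^ (n + 1)).map (LinearMap.mulLeft k a))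
      (fun i v => ⟨l i * v, by
        rw [pow_succ']
        exact Submodule.mul_mem_mul (Submodule.subset_span ⟨i, rfl⟩) v.2, by simp [φ]⟩)
      t₀ (by rwa [hφ])
    simpa only [hφ] using key
  push Not at hex
  have hlt (t : k) : Module.finrank k ((L ^ n).map (LinearMap.mulLeft k (a * y t))) ≤ n := by
    have := hfd (n + 1) a
    have := Submodule.finrank_lt_finrank_of_lt ((hle n a t).lt_of_not_ge (hex t))
    omega
  let e : Fin d ↪ k := Fin.valEmbedding.trans (Infinite.natEmbedding k)
  cases n with
  | zero =>
    refine (hex 0 ?_).elim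
    refine Submodule.map_mulLeft_pow_succ_le l a (y 0) 0 e fun j => ?_
    have := hfd 0 (a * y (e j))
    have h0 := Submodule.finrank_eq_zero.1 (Nat.le_zero.1 (hlt (e j)))
    exact h0.le.trans bot_le
  | succ n =>
    have ih := fun j : Fin d => finite_setOf_not_map_mulLeft_pow_succ_le l n (a * y (e j)) (hlt
    (e j))
    -- Outside the finitely many exceptional parameters for the `d` fixed points, each `a y(e j)
    -- Lⁿ⁺¹` lies in `a y(e j) y(t) Lⁿ`, hence in `a y(t) Lⁿ⁺¹`; these `d` inclusions suffice.
    refine (Set.finite_iUnion ih).subset fun t ht => ?_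
    by_contra hnot
    simp only [Set.mem_iUnion, not_exists, Set.mem_ofPred_eq, not_not] at hnot
    refine ht (Submodule.map_mulLeft_pow_succ_le l a (y t) (n + 1) e fun j => (hnot j).trans ?_)
    rw [show a * y (e j) * ∑ i : Fin d, t ^ (i : ℕ) • l i = a * y t * y (e j) by
      simp only [hy]; ring]
    exact hle n (a * y t) (e j)

end Field

/-! ### The Eakin–Sathaye theorem over a local ring -/

theorem Submodule.finrank_eq_spanFinrank {k V : Type*} [Field k] [AddCommGroup V] [Module k V]
    (W : Submodule k V) : Module.finrank k W = W.spanFinrank := by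
  rw [Module.finrank_eq_spanFinrank_of_free, Submodule.spanFinrank_top]

section FiberCone

open IsLocalRing

variable {R : Type*} [CommRing R] [IsLocalRing R] (J : Ideal R)

/-- The fiber cone `⨁ Jⁿ / 𝔪 Jⁿ` of an ideal of a local ring. -/
abbrev FiberCone : Type _ :=
  reesAlgebra J ⧸ (maximalIdeal R).map (algebraMap R (reesAlgebra J))

noncomputable instance : Algebra (ResidueField R) (FiberCone J) :=
  RingHom.toAlgebra (R := ResidueField R) (S := FiberCone J) <|
    Ideal.Quotient.lift (maximalIdeal R) ((Ideal.Quotient.mk _).comp (algebraMap R (reesAlgebra J)))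
      fun _ hr => Ideal.Quotient.eq_zero_iff_mem.2 (Ideal.mem_map_of_mem _ hr)

noncomputable instance : Module (ResidueField R) (FiberCone J) := Algebra.toModule

instance : RingHomSurjective (residue R) := ⟨residue_surjective⟩

theorem residue_smul_fiberCone_mk (r : R) (z : reesAlgebra J) :
    residue R r • (Ideal.Quotient.mk _ z : FiberCone J) = Ideal.Quotient.mk _ (r • z) := by
  rw [Algebra.smul_def, Algebra.smul_def, map_mul]
  rfl

/-- The element `u tⁿ` of the Rees algebra, for `u ∈ Jⁿ`. -/
noncomputable def reesMonomial (n : ℕ) : ↥(J ^ n) →ₗ[R] reesAlgebra J :=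
  LinearMap.codRestrict (Subalgebra.toSubmodule (reesAlgebra J))
    ((Polynomial.monomial n : R →ₗ[R] Polynomial R) ∘ₗ (J ^ n).subtype)
    (fun x => reesAlgebra.monomial_mem.2 x.2)

set_option linter.unusedSectionVars false in
theorem coe_reesMonomial (n : ℕ) (u : ↥(J ^ n)) :
    (reesMonomial J n u : Polynomial R) = Polynomial.monomial n (u : R) := rfl

/-- The projection of `Jⁿ` onto the degree `n` part of the fiber cone. -/
noncomputable def fiberConeDegree (n : ℕ) : ↥(J ^ n) →ₛₗ[residue R] FiberCone J where
  toFun u := Ideal.Quotient.mk _ (reesMonomial J n u)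
  map_add' u v := by simp
  map_smul' r u := by rw [residue_smul_fiberCone_mk, map_smul]

theorem fiberConeDegree_mul {m n N : ℕ} (h : m + n = N) (u : ↥(J ^ m)) (v : ↥(J ^ n)) :
    fiberConeDegree J m u * fiberConeDegree J n v =
      fiberConeDegree J N ⟨u * v, by rw [← h, pow_add]; exact Ideal.mul_mem_mul u.2 v.2⟩ := by
  subst h
  change Ideal.Quotient.mk _ _ * Ideal.Quotient.mk _ _ = Ideal.Quotient.mk _ _
  rw [← map_mul]
  congr 1
  exact Subtype.ext (Polynomial.monomial_mul_monomial m n _ _)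

/-- The fiber cone is generated in degree one, so the powers of `J` become powers of a single
subspace, as the field version requires. -/
theorem range_fiberConeDegree (n : ℕ) : LinearMap.range (fiberConeDegree J n) =
    LinearMap.range (fiberConeDegree J 1) ^ n := by
  induction n with
  | zero =>
    have hone : fiberConeDegree J 0 ⟨1, by simp⟩ = 1 := by
      change Ideal.Quotient.mk _ _ = _
      rw [← map_one (Ideal.Quotient.mk _)]
      rfl
    rw [pow_zero (M := Submodule (ResidueField R) (FiberCone J)), Submodule.one_eq_span, ← hone]
    apply le_antisymm
    · rintro _ ⟨u, rfl⟩
      refine Submodule.mem_span_singleton.2 ⟨residue R u, ?_⟩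
      rw [← map_smulₛₗ]
      congr 1
      ext
      simp
    · rw [Submodule.span_singleton_le_iff_mem]
      exact ⟨_, rfl⟩
  | succ n ih =>
    rw [pow_succ' (M := Submodule (ResidueField R) (FiberCone J)), ← ih]
    apply le_antisymm
    · rintro _ ⟨⟨u, hu⟩, rfl⟩
      have key : ∀ u ∈ J * J ^ n, ∃ hu : u ∈ J ^ (n + 1), fiberConeDegree J (n + 1) ⟨u, hu⟩ ∈
          LinearMap.range (fiberConeDegree J 1) * LinearMap.range (fiberConeDegree J n) := by
        intro u hu
        refine Submodule.mul_induction_on hu (fun a ha b hb => ?_) fun x y hx hy => ?_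
        · refine ⟨by rw [pow_succ']; exact Ideal.mul_mem_mul ha hb, ?_⟩
          have := Submodule.mul_mem_mul
            (LinearMap.mem_range_self (fiberConeDegree J 1) ⟨a, by simpa using ha⟩)
            (LinearMap.mem_range_self (fiberConeDegree J n) ⟨b, hb⟩)
          rwa [fiberConeDegree_mul J (add_comm 1 n)] at this
        · obtain ⟨hx, hx'⟩ := hx
          obtain ⟨hy, hy'⟩ := hy
          refine ⟨add_mem hx hy, ?_⟩
          have := add_mem hx' hy'
          rwa [← map_add] at this
      exact (key u (by rwa [← pow_succ'])).2
    · rw [Submodule.mul_le]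
      rintro _ ⟨u, rfl⟩ _ ⟨v, rfl⟩
      rw [fiberConeDegree_mul J (add_comm 1 n)]
      exact ⟨_, rfl⟩

/-- This identifies what is killed in degree `j` of the fiber cone: vanishing there means lying in
`𝔪 Jʲ`, the form needed for Nakayama. -/
theorem coeff_mem_of_mem_map_maximalIdeal {z : reesAlgebra J}
    (hz : z ∈ (maximalIdeal R).map (algebraMap R (reesAlgebra J))) (j : ℕ) :
    (z : Polynomial R).coeff j ∈ maximalIdeal R * J ^ j := by
  induction hz using Submodule.span_induction generalizing j with
  | mem x hx =>
    obtain ⟨r, hr, rfl⟩ := hx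
    change (Polynomial.C r).coeff j ∈ _
    rw [Polynomial.coeff_C]
    split_ifs with h
    · subst h; simpa using hr
    · exact zero_mem _
  | zero => simp
  | add x y _ _ hx hy => simpa using add_mem (hx j) (hy j)
  | smul a x _ hx =>
    change ((a : Polynomial R) * x).coeff j ∈ _
    rw [Polynomial.coeff_mul]
    refine Ideal.sum_mem _ fun p hp => ?_
    rw [← Finset.HasAntidiagonal.mem_antidiagonal.1 hp, pow_add, mul_left_comm]
    exact Ideal.mul_mem_mul (a.2 p.1) (hx p.2)

/-- The Eakin–Sathaye theorem for one element: over a local ring with infinite residue field, if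
`Jⁿ⁺¹` is generated by `n + 1` elements, then `Jⁿ⁺¹ = y Jⁿ` for some `y ∈ J`. -/
theorem Ideal.exists_pow_succ_eq_span_singleton_mul [Infinite (IsLocalRing.ResidueField R)]
    (hJ : J.FG) (n : ℕ)
    (h : (J ^ (n + 1)).spanFinrank ≤ n + 1) :
    ∃ y ∈ J, J ^ (n + 1) = Ideal.span {y} * J ^ n := by
  obtain ⟨d, f, hf⟩ : ∃ (d : ℕ) (l : Fin d → FiberCone J),
      LinearMap.range (fiberConeDegree J 1) =
        Submodule.span (IsLocalRing.ResidueField R) (Set.range l) := by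
    have : (LinearMap.range (fiberConeDegree J 1)).FG := by
      rw [LinearMap.range_eq_map]
      refine Submodule.FG.map _ ((Submodule.fg_top _).2 ?_)
      rwa [pow_one]
    obtain ⟨d, l, hl⟩ := Submodule.fg_iff_exists_fin_generating_family.1 this
    exact ⟨d, l, hl.symm⟩
  have hrank : Module.finrank (IsLocalRing.ResidueField R)
      (LinearMap.range (fiberConeDegree J (n + 1))) ≤ n + 1 := by
    have hfg : (J ^ (n + 1)).FG := hJ.pow
    rw [Submodule.finrank_eq_spanFinrank, LinearMap.range_eq_map]
    refine (Submodule.spanFinrank_map_le_of_fg _ ((Submodule.fg_top _).2 hfg)).trans ?_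
    rwa [Submodule.spanFinrank_top]
  -- The multiplier `a` serves only the induction; here it is `1`.
  have hfin := finite_setOf_not_map_mulLeft_pow_succ_le f n 1 (by
    rw [← hf, ← range_fiberConeDegree]
    rwa [LinearMap.mulLeft_one, Submodule.map_id])
  obtain ⟨t, ht⟩ := hfin.infinite_compl.nonempty
  simp only [Set.mem_compl_iff, Set.mem_ofPred_eq, not_not, ← hf, ← range_fiberConeDegree,
    one_mul] at ht
  obtain ⟨⟨y, hy⟩, hyt⟩ : ∑ i : Fin d, t ^ (i : ℕ) • f i ∈ LinearMap.range (fiberConeDegree J 1) := by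
    rw [hf]
    exact Submodule.sum_mem _ fun i _ => Submodule.smul_mem _ _ (Submodule.subset_span ⟨i, rfl⟩)
  rw [← hyt] at ht
  have hyJ : y ∈ J := by simpa using hy
  refine ⟨y, hyJ, le_antisymm ?_ ?_⟩
  · refine Submodule.le_of_le_smul_of_le_jacobson_bot (I := maximalIdeal R) hJ.pow
      (IsLocalRing.maximalIdeal_le_jacobson _) ?_
    intro u hu
    obtain ⟨_, ⟨v, rfl⟩, hv⟩ := ht ⟨_, ⟨⟨u, hu⟩, rfl⟩, rfl⟩
    simp only [LinearMap.mulLeft_apply, one_mul] at hv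
    rw [fiberConeDegree_mul J (add_comm 1 n)] at hv
    have hmem := coeff_mem_of_mem_map_maximalIdeal J (Ideal.Quotient.eq.1 hv) (n + 1)
    have : y * v - u ∈ maximalIdeal R * J ^ (n + 1) := by
      simpa [coe_reesMonomial, Polynomial.coeff_monomial] using hmem
    rw [show u = y * v + -(y * v - u) by ring]
    exact Submodule.add_mem_sup (Ideal.mul_mem_mul (Ideal.mem_span_singleton_self y) v.2)
      (neg_mem this)
  · rw [pow_succ']
    exact Ideal.mul_mono_left ((Ideal.span_singleton_le_iff_mem _).2 hyJ)

end FiberCone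

/-! ### Number of generators and lengths -/

section Length

open IsLocalRing

variable {R : Type*} [CommRing R]

/-- Additivity along `0 → J/IJ → R/IJ → R/J → 0`. -/
theorem Ideal.length_quotient_mul_eq_add (I J : Ideal R) :
    Module.length R (R ⧸ I * J) =
      Module.length R (J ⧸ I • (⊤ : Submodule R J)) + Module.length R (R ⧸ J) := by
  have hmap : Submodule.map (Submodule.subtype J) (I • (⊤ : Submodule R J)) = I * J := by
    rw [Submodule.map_smul'', Submodule.map_top, Submodule.range_subtype]
    rfl
  have hle : I • (⊤ : Submodule R J) ≤ Submodule.comap (Submodule.subtype J) (I * J) := by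
    rw [← Submodule.map_le_iff_le_comap, hmap]
  refine Module.length_eq_add_of_exact (Submodule.mapQ _ (I * J) (Submodule.subtype J) hle)
    (Submodule.factor Ideal.mul_le_right) ?_ (Submodule.factor_surjective _) ?_
  · rw [injective_iff_map_eq_zero]
    intro u hu
    obtain ⟨u, rfl⟩ := Submodule.Quotient.mk_surjective _ u
    rw [Submodule.mapQ_apply, Submodule.Quotient.mk_eq_zero, ← hmap] at hu
    obtain ⟨v, hv, hvu⟩ := hu
    rw [Submodule.Quotient.mk_eq_zero, ← Subtype.ext hvu]
    exact hv
  · intro u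
    obtain ⟨u, rfl⟩ := Submodule.Quotient.mk_surjective _ u
    change Submodule.factor _ (Submodule.mkQ _ u) = 0 ↔ _
    rw [Submodule.factor_mk, Submodule.mkQ_apply, Submodule.Quotient.mk_eq_zero]
    constructor
    · intro hu
      exact ⟨Submodule.Quotient.mk ⟨u, hu⟩, rfl⟩
    · rintro ⟨v, hv⟩
      obtain ⟨v, rfl⟩ := Submodule.Quotient.mk_surjective _ v
      rw [Submodule.mapQ_apply, Submodule.Quotient.eq] at hv
      rw [← sub_sub_cancel (v : R) u]
      exact sub_mem v.2 (Ideal.mul_le_right hv)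

/-- Additivity along `0 → R/J → R/xJ → R/x → 0`, whose first map is multiplication by `x`. -/
theorem Ideal.length_quotient_span_singleton_mul {x : R} (hx : x ∈ nonZeroDivisors R)
    (J : Ideal R) :
    Module.length R (R ⧸ Ideal.span {x} * J) =
      Module.length R (R ⧸ J) + Module.length R (R ⧸ Ideal.span {x}) := by
  have h := Module.length_eq_add_of_exact _ _ (Ideal.mulQuot_injective J hx)
    (Ideal.quotOfMul_surjective J (a := x)) (Ideal.exact_mulQuot_quotOfMul J)
  rw [← h, Submodule.ideal_span_singleton_smul x J |>.symm]
  rfl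

variable [IsLocalRing R]

theorem IsLocalRing.length_quotient_maximalIdeal_smul_top {J : Ideal R} (hJ : J.FG) :
    Module.length R (J ⧸ maximalIdeal R • (⊤ : Submodule R J)) = J.spanFinrank := by
  have : Module.Finite R J := Module.Finite.iff_fg.2 hJ
  let : Module (ResidueField R) (J ⧸ maximalIdeal R • (⊤ : Submodule R J)) :=
    inferInstanceAs (Module (R ⧸ maximalIdeal R) _)
  have : IsScalarTower R (ResidueField R) (J ⧸ maximalIdeal R • (⊤ : Submodule R J)) :=
    inferInstanceAs (IsScalarTower R (R ⧸ maximalIdeal R) _)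
  have : Module.Finite (ResidueField R) (J ⧸ maximalIdeal R • (⊤ : Submodule R J)) :=
    Module.Finite.of_restrictScalars_finite R _ _
  rw [IsLocalRing.spanFinrank_eq_finrank_quotient J hJ,
    Module.length_eq_of_surjective (R := ResidueField R) residue_surjective,
    Module.length_eq_finrank]
  rfl

/-- In a local ring, an ideal of finite colength has at most `length (R / x)` generators, for every
nonzerodivisor `x` in the maximal ideal. -/
theorem Ideal.spanFinrank_le_length_quotient_span_singleton {x : R} (hx : x ∈ nonZeroDivisors R)
    (hxm : x ∈ maximalIdeal R) {J : Ideal R} (hJ : J.FG) (hlen : Module.length R (R ⧸ J) ≠ ⊤) :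
    (J.spanFinrank : ℕ∞) ≤ Module.length R (R ⧸ Ideal.span {x}) := by
  have hle : Ideal.span {x} * J ≤ maximalIdeal R * J :=
    Ideal.mul_mono_left ((Ideal.span_singleton_le_iff_mem _).2 hxm)
  -- Compare `ℓ(R/𝔪J) = μ(J) + ℓ(R/J)` with `ℓ(R/xJ) = ℓ(R/J) + ℓ(R/x)` and cancel the finite term
  -- `ℓ(R/J)`.
  have h := Module.length_le_of_surjective _ (Submodule.factor_surjective hle)
  rw [Ideal.length_quotient_span_singleton_mul hx, Ideal.length_quotient_mul_eq_add,
    IsLocalRing.length_quotient_maximalIdeal_smul_top hJ, add_comm] at h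
  exact (ENat.add_le_add_iff_left hlen).1 h

end Length

/-! ### The local extension `A(X)` -/

section GenericExtension

open IsLocalRing

variable (A : Type*) [CommRing A] [IsLocalRing A]

/-- The ring `A(X)`, the localization of `A[X]` at the extension of the maximal ideal. -/
abbrev GenericExtension : Type _ :=
  Localization.AtPrime ((maximalIdeal A).map (Polynomial.C : A →+* Polynomial A))

namespace GenericExtension

theorem map_maximalIdeal : (maximalIdeal A).map (algebraMap A (GenericExtension A)) =
    maximalIdeal (GenericExtension A) := by
  rw [IsScalarTower.algebraMap_eq A (Polynomial A), ← Ideal.map_map,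
    ← Localization.AtPrime.map_eq_maximalIdeal]
  rfl

instance : IsLocalHom (algebraMap A (GenericExtension A)) :=
  ((local_hom_TFAE _).out 0 2).2 (map_maximalIdeal A).le

instance : Module.Flat A (GenericExtension A) := Module.Flat.trans A (Polynomial A) _

instance : Module.FaithfullyFlat A (GenericExtension A) :=
  Module.FaithfullyFlat.of_flat_of_isLocalHom

instance : Infinite (ResidueField (GenericExtension A)) := by
  refine Infinite.of_injective
    (fun n : ℕ => residue _ (algebraMap (Polynomial A) (GenericExtension A) (Polynomial.X ^ n))) ?_
  intro m n h
  -- Membership in the extended maximal ideal is tested on coefficients, and `X ^ m - X ^ n` has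
  -- coefficient `1` at `m`.
  by_contra hne
  have h' : algebraMap (Polynomial A) (GenericExtension A) (Polynomial.X ^ m - Polynomial.X ^ n) ∈
      maximalIdeal (GenericExtension A) := by
    rw [map_sub]
    exact Ideal.Quotient.eq.1 h
  rw [← Ideal.mem_comap, ← Ideal.under_def, Localization.AtPrime.under_maximalIdeal,
    Ideal.mem_map_C_iff] at h'
  have := h' m
  rw [Polynomial.coeff_sub, Polynomial.coeff_X_pow_self, Polynomial.coeff_X_pow, if_neg hne,
    sub_zero] at this
  exact (Ideal.ne_top_iff_one _).1 (maximalIdeal.isMaximal A).ne_top this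

end GenericExtension

end GenericExtension

/-! ### Reductions and the multiplicity -/

section Multiplicity

open IsLocalRing Filter

/-- Flat local base change multiplies length by the length of the closed fiber, which is a field
here. -/
theorem IsLocalRing.length_quotient_map {A B : Type*} [CommRing A] [IsLocalRing A] [CommRing B]
    [IsLocalRing B] [Algebra A B] [Module.Flat A B] [IsLocalHom (algebraMap A B)]
    (hmax : (maximalIdeal A).map (algebraMap A B) = maximalIdeal B) (I : Ideal A) :
    Module.length B (B ⧸ I.map (algebraMap A B)) = Module.length A (A ⧸ I) := by
  have : IsSimpleModule B (B ⧸ maximalIdeal B) :=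
    isSimpleModule_iff_isCoatom.2 (maximalIdeal.isMaximal B).out
  rw [(Algebra.TensorProduct.quotIdealMapEquivTensorQuot B I).toLinearEquiv.length_eq,
    IsLocalRing.length_baseChange, hmax, Module.length_eq_one B (B ⧸ maximalIdeal B), mul_one]

theorem Ideal.length_quotient_ne_top_of_pow_mem {R : Type*} [CommRing R] {x : R}
    (hx : x ∈ nonZeroDivisors R) (hlen : Module.length R (R ⧸ Ideal.span {x}) ≠ ⊤) {J : Ideal R}
    {n : ℕ} (hJ : x ^ n ∈ J) : Module.length R (R ⧸ J) ≠ ⊤ := by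
  have h1 := Module.length_le_of_surjective _
    (Submodule.factor_surjective ((Ideal.span_singleton_le_iff_mem J).2 hJ))
  have h2 := Ring.ord_pow (R := R) hx n
  rw [Ring.ord, Ring.ord] at h2
  refine ne_top_of_le_ne_top ?_ (h1.trans h2.le)
  rw [nsmul_eq_mul]
  exact WithTop.mul_ne_top (ENat.natCast_ne_top n) hlen

/-- Over a local ring with infinite residue field, if `length (R / x) = r + 1` for some
nonzerodivisor `x ∈ 𝔪`, then every finitely generated ideal `J` containing a power of a
nonzerodivisor `z` of finite colength satisfies `Jʳ⁺¹ = y Jʳ` for some `y ∈ J`. -/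
theorem Ideal.exists_pow_succ_eq_of_length_eq {R : Type*} [CommRing R] [IsLocalRing R]
    [Infinite (IsLocalRing.ResidueField R)] {x : R} (hx : x ∈ nonZeroDivisors R)
    (hxm : x ∈ maximalIdeal R)
    {r : ℕ} (hlen : Module.length R (R ⧸ Ideal.span {x}) = (r + 1 : ℕ)) {z : R}
    (hz : z ∈ nonZeroDivisors R) (hzlen : Module.length R (R ⧸ Ideal.span {z}) ≠ ⊤)
    {J : Ideal R} (hJ : J.FG) {n : ℕ} (hn : z ^ n ∈ J) : ∃ y ∈ J, J ^ (r + 1) = Ideal.span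
    {y} * J ^ r := by
  refine Ideal.exists_pow_succ_eq_span_singleton_mul J hJ r ?_
  have hmem : z ^ (n * (r + 1)) ∈ J ^ (r + 1) := by
    rw [pow_mul]
    exact Ideal.pow_mem_pow hn _
  have := Ideal.spanFinrank_le_length_quotient_span_singleton hx hxm (J := J ^ (r + 1)) hJ.pow
    (Ideal.length_quotient_ne_top_of_pow_mem hz hzlen hmem)
  rw [hlen] at this
  exact_mod_cast this

theorem exists_length_quotient_span_singleton_eq_succ {R : Type*} [CommRing R] [IsLocalRing R]
    {x : R}
    (hxm : x ∈ maximalIdeal R) (hlen : Module.length R (R ⧸ Ideal.span {x}) ≠ ⊤) :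
    ∃ r : ℕ, Module.length R (R ⧸ Ideal.span {x}) = (r + 1 : ℕ) := by
  obtain ⟨c, hc⟩ := ENat.ne_top_iff_exists.1 hlen
  have : Nontrivial (R ⧸ Ideal.span {x}) := Ideal.Quotient.nontrivial_iff.2 fun h =>
    (maximalIdeal.isMaximal R).ne_top (top_le_iff.1 (h ▸ (Ideal.span_singleton_le_iff_mem _).2 hxm))
  have hpos := Module.length_pos (R := R) (M := R ⧸ Ideal.span {x})
  rw [← hc] at hpos ⊢
  obtain ⟨r, rfl⟩ := Nat.exists_eq_succ_of_ne_zero (Nat.cast_pos.1 hpos).ne'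
  exact ⟨r, rfl⟩

theorem Ideal.pow_add_eq_span_singleton_pow_mul {R : Type*} [CommRing R] {J : Ideal R} {y : R}
    {s : ℕ}
    (h : J ^ (s + 1) = Ideal.span {y} * J ^ s) (n : ℕ) :
    J ^ (s + n) = Ideal.span {y ^ n} * J ^ s := by
  induction n with
  | zero => simp
  | succ n ih =>
    rw [← add_assoc, pow_succ, ih, mul_assoc, ← pow_succ, h, ← mul_assoc,
      Ideal.span_singleton_mul_span_singleton, pow_succ]

/-- The shift by `s` is harmless because `n r / (n + s)` tends to `r`. -/
theorem natCast_le_limsup_of_mul_le {f : ℕ → ℕ∞} {r s : ℕ}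
    (h : ∀ n, ((n * r : ℕ) : ℕ∞) ≤ f (s + n)) :
    (r : ENNReal) ≤ limsup (fun n : ℕ => ((1 : ℕ).factorial : ENNReal) * (f n : ENNReal) /
      (n : ENNReal) ^ 1) atTop := by
  have hlim : Tendsto (fun n : ℕ => ENNReal.ofReal ((n * r : ℝ) / (n + s))) atTop
      (nhds (ENNReal.ofReal r)) := by
    refine ENNReal.tendsto_ofReal ?_
    have := (tendsto_natCast_div_add_atTop (s : ℝ)).mul_const (r : ℝ)
    rw [one_mul] at this
    refine this.congr fun n => ?_
    ring
  rw [ENNReal.ofReal_natCast] at hlim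
  rw [← hlim.limsup_eq, ← Filter.limsup_nat_add (fun n : ℕ => ((1 : ℕ).factorial : ENNReal) *
    (f n : ENNReal) / (n : ENNReal) ^ 1) s]
  refine limsup_le_limsup ?_
  filter_upwards [eventually_gt_atTop 0] with n hn
  have hpos : (0 : ℝ) < n + s := by positivity
  rw [ENNReal.ofReal_div_of_pos hpos, add_comm n s]
  have h1 : ENNReal.ofReal (n * r : ℝ) = ((n * r : ℕ) : ENNReal) := by
    rw [← ENNReal.ofReal_natCast]; push_cast; rfl
  have h2 : ENNReal.ofReal (n + s : ℝ) = ((s + n : ℕ) : ENNReal) := by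
    rw [← ENNReal.ofReal_natCast]; push_cast; rw [add_comm]
  rw [h1, h2, Nat.factorial_one, Nat.cast_one, one_mul, pow_one]
  gcongr
  exact_mod_cast h n

/-- There is a number `r + 1 ≤ e(A)` such that every finitely generated ideal of `A(X)` containing
a power of `x` has a principal reduction with reduction number at most `r`. -/
theorem exists_reductionNumber_lt_multiplicity (A : Type*) [CommRing A] [IsLocalRing A]
    [IsNoetherianRing A] [Ring.KrullDimLE 1 A] {x : A} (hx : x ∈ nonZeroDivisors A)
    (hxm : x ∈ maximalIdeal A) : ∃ r : ℕ,
      ((r + 1 : ℕ) : ENNReal) ≤ limsup (fun n : ℕ => ((1 : ℕ).factorial : ENNReal) *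
        ((Module.length A (A ⧸ maximalIdeal A ^ n) : ℕ∞) : ENNReal) / (n : ENNReal) ^ 1) atTop ∧
      ∀ (J : Ideal (GenericExtension A)), J.FG → ∀ n, algebraMap A (GenericExtension A) x ^ n ∈ J →
        ∃ y ∈ J, J ^ (r + 1) = Ideal.span {y} * J ^ r := by
  set B := GenericExtension A
  have hmax := GenericExtension.map_maximalIdeal A
  set x' : B := algebraMap A B x with hx'
  have hreg : x' ∈ nonZeroDivisors B := by
    refine mem_nonZeroDivisors_iff_right.2 fun z hz => ?_
    refine Module.Flat.isSMulRegular_of_nonZeroDivisors (M := B) hx ?_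
    simp only [Algebra.smul_def]
    rwa [mul_comm, mul_zero]
  have hxm' : x' ∈ maximalIdeal B := by
    rw [← hmax]; exact Ideal.mem_map_of_mem _ hxm
  have hlen : Module.length B (B ⧸ Ideal.span {x'}) ≠ ⊤ := by
    have := IsLocalRing.length_quotient_map hmax (Ideal.span {x})
    rw [Ideal.map_span, Set.image_singleton] at this
    rw [this]
    exact Ring.ord_ne_top hx
  obtain ⟨s, hs⟩ := exists_length_quotient_span_singleton_eq_succ hxm' hlen
  have hfg : (maximalIdeal B).FG := by
    rw [← hmax]; exact Ideal.FG.map (IsNoetherian.noetherian (maximalIdeal A)) _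
  -- First use of the reduction bound, with the maximal ideal as `J`. The number `s` need not be
  -- bounded by the multiplicity; only the element `y` is kept.
  obtain ⟨y, hym, hy⟩ := Ideal.exists_pow_succ_eq_of_length_eq hreg hxm' hs hreg hlen hfg (n := 1)
    (by simpa using hxm')
  have hxy : x' ^ (s + 1) ∈ Ideal.span {y} :=
    Ideal.mul_le_left (hy ▸ Ideal.pow_mem_pow hxm' (s + 1))
  have hyreg : y ∈ nonZeroDivisors B := by
    obtain ⟨z, hz⟩ := Ideal.mem_span_singleton'.1 hxy
    exact (mul_mem_nonZeroDivisors.1 (hz ▸ pow_mem hreg (s + 1))).2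
  have hylen := Ideal.length_quotient_ne_top_of_pow_mem hreg hlen hxy
  obtain ⟨r, hr⟩ := exists_length_quotient_span_singleton_eq_succ hym hylen
  refine ⟨r, natCast_le_limsup_of_mul_le
    (f := fun n => Module.length A (A ⧸ maximalIdeal A ^ n)) (s := s) fun n => ?_, ?_⟩
  -- From `𝔪 ^ (s + n) = yⁿ 𝔪ˢ ⊆ (yⁿ)` one gets `ℓ(A/𝔪 ^ (s + n)) ≥ ℓ(B/yⁿ) = n (r + 1)`.
  · rw [← IsLocalRing.length_quotient_map hmax, Ideal.map_pow, hmax,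
      Ideal.pow_add_eq_span_singleton_pow_mul hy]
    have h1 := Ring.ord_pow (R := B) hyreg n
    rw [Ring.ord, Ring.ord, hr, nsmul_eq_mul] at h1
    rw [Nat.cast_mul, ← h1]
    exact Module.length_le_of_surjective _ (Submodule.factor_surjective Ideal.mul_le_left)
  · intro J hJ n hn
    -- Second use: `y` now controls the number of generators, while `x'` still witnesses finite
    -- colength.
    exact Ideal.exists_pow_succ_eq_of_length_eq hyreg hym hr hreg hlen hJ hn

end Multiplicity

/-! ### Vanishing of Koszul-type relations after a faithfully flat base change -/

section Descent

variable {A B : Type*} [CommRing A] [CommRing B] [Algebra A B] [Module.FaithfullyFlat A B]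
  {I : Ideal A} {D G M C : Type*} [AddCommGroup D] [Module A D] [AddCommGroup G] [Module A G]
  [AddCommGroup M] [Module A M] [AddCommGroup C] [Module A C]

/-- In the application `D` is `S_p(I) ⊗ M`, `G` is `I ^ (p + 1) M` as a quotient of `S_{p+1}(I) ⊗
M`, and `C` is `S(I) ⊗ M` modulo induced relations. Dividing each `g k` by `y` and commuting the two
multiplications reduces the claim to `∑ x_k u_k = 0` in `B ⊗ G`. Faithful flatness descends the
conclusion. -/
theorem sum_eq_zero_of_faithfullyFlat (act : I → D →ₗ[A] G) (j₀ : D →ₗ[A] M) (j₁ : G →ₗ[A] M)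
    (hj₁ : Function.Injective j₁) (hact : ∀ x u, j₁ (act x u) = (x : A) • j₀ u)
    (θ : I → G →ₗ[A] C) (hθ : ∀ x x' u, θ x (act x' u) = θ x' (act x u)) {y : B}
    (hyI : y ∈ I.map (algebraMap A B)) (hreg : ∀ v : B ⊗[A] M, y • v = 0 → v = 0)
    (hG : ∀ g, ∃ u : B ⊗[A] D, (1 : B) ⊗ₜ[A] j₁ g = y • j₀.baseChange B u)
    {κ : Type*} [Fintype κ] (x : κ → I) (g : κ → G) (h : ∑ k, (x k : A) • j₁ (g k) = 0) :
    ∑ k, θ (x k) (g k) = 0 := by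
  obtain ⟨d, b, a', hy⟩ := Submodule.mem_span_set'.1 hyI
  choose a ha ha' using fun i => (a' i).2
  replace hy : ∑ i, b i * algebraMap A B (a i) = y := by simpa only [ha', smul_eq_mul] using hy
  -- As `y` need not come from `A`, multiplication by `y` is assembled from an expression `y = ∑ bᵢ
  -- aᵢ` with `aᵢ ∈ I`.
  let Tact : B ⊗[A] D →ₗ[B] B ⊗[A] G := ∑ i, b i • (act ⟨a i, ha i⟩).baseChange B
  let Tθ : B ⊗[A] G →ₗ[B] B ⊗[A] C := ∑ i, b i • (θ ⟨a i, ha i⟩).baseChange B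
  have hj₁B : Function.Injective (j₁.baseChange B) :=
    Module.Flat.lTensor_preserves_injective_linearMap (M := B) j₁ hj₁
  have hactB (z : I) (u : B ⊗[A] D) : j₁.baseChange B ((act z).baseChange B u) =
      algebraMap A B z • j₀.baseChange B u := by
    induction u with
    | zero => simp
    | add u v hu hv => simp only [map_add, hu, hv, smul_add]
    | tmul c u =>
      simp only [LinearMap.baseChange_tmul, hact, TensorProduct.tmul_smul, algebraMap_smul]
  have hTact (u : B ⊗[A] D) : j₁.baseChange B (Tact u) = y • j₀.baseChange B u := by
    simp only [Tact, LinearMap.sum_apply, LinearMap.smul_apply, map_sum, map_smul, hactB, smul_smul,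
      ← Finset.sum_smul, hy]
  have hcomm (z : I) (u : B ⊗[A] D) :
      (θ z).baseChange B (Tact u) = Tθ ((act z).baseChange B u) := by
    simp only [Tact, Tθ, LinearMap.sum_apply, LinearMap.smul_apply, map_sum, map_smul]
    refine Finset.sum_congr rfl fun i _ => congrArg _ ?_
    induction u with
    | zero => simp
    | add u v hu hv => simp only [map_add, hu, hv]
    | tmul c u => simp only [LinearMap.baseChange_tmul, hθ z]
  choose u hu using fun k => hG (g k)
  have hgu (k : κ) : (1 : B) ⊗ₜ[A] g k = Tact (u k) := by
    apply hj₁B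
    rw [hTact, ← hu, LinearMap.baseChange_tmul]
  have hw : ∑ k, (act (x k)).baseChange B (u k) = 0 := by
    apply hj₁B
    rw [map_zero]
    apply hreg
    have h1 (k : κ) : y • algebraMap A B (x k) • j₀.baseChange B (u k) =
        (1 : B) ⊗ₜ[A] ((x k : A) • j₁ (g k)) := by
      rw [smul_comm, ← hu, algebraMap_smul, TensorProduct.tmul_smul]
    simp only [map_sum, hactB, Finset.smul_sum, h1]
    rw [← TensorProduct.tmul_sum, h, TensorProduct.tmul_zero]
  apply Module.FaithfullyFlat.tensorProduct_mk_injective (A := A) (B := B) C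
  simp only [map_sum, TensorProduct.mk_apply, map_zero]
  have h2 (k : κ) : (1 : B) ⊗ₜ[A] θ (x k) (g k) = Tθ ((act (x k)).baseChange B (u k)) := by
    rw [← hcomm, ← hgu, LinearMap.baseChange_tmul]
  simp only [h2]
  rw [← map_sum, hw, map_zero]

end Descent

/-! ### The graded structure of the symmetric presentation -/

namespace RelationType

universe u v

variable {A : Type u} [CommRing A] (I : Ideal A) (M : Type v) [AddCommGroup M] [Module A M]

/-- The degree `n` component `S(I) ⊗ M → M` of the symmetric presentation `γ`. -/
noncomputable def presentationCoeff (n : ℕ) : SymmetricAlgebra A I ⊗[A] M →ₗ[A] M where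
  toFun z := (symPresentation I M z : PolynomialModule A M).coeff n
  map_add' z w := by simp
  map_smul' a z := by
    rw [map_smul]
    rfl

variable {I M}

theorem presentationCoeff_tmul (n : ℕ) (s : SymmetricAlgebra A I) (m : M) :
    presentationCoeff I M n (s ⊗ₜ m) = (symToRees I s : Polynomial A).coeff n • m := by
  change ((symToRees I s : Polynomial A) • PolynomialModule.single A 0 m).coeff n = _
  simp

theorem coe_symToRees_ι (x : I) :
    (symToRees I (SymmetricAlgebra.ι A I x) : Polynomial A) = Polynomial.monomial 1 (x : A) := by
  rw [symToRees, SymmetricAlgebra.lift_ι_apply]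
  rfl

theorem presentationCoeff_succ_ι_smul (n : ℕ) (x : I) (z : SymmetricAlgebra A I ⊗[A] M) :
    presentationCoeff I M (n + 1) (SymmetricAlgebra.ι A I x • z) =
      (x : A) • presentationCoeff I M n z := by
  induction z with
  | zero => simp
  | add z w hz hw => simp only [smul_add, map_add, hz, hw]
  | tmul s m =>
    rw [TensorProduct.smul_tmul', smul_eq_mul, presentationCoeff_tmul, presentationCoeff_tmul,
      map_mul, Subalgebra.coe_mul, coe_symToRees_ι, Polynomial.coeff_monomial_mul, mul_smul]

theorem presentationCoeff_zero_ι_smul (x : I) (z : SymmetricAlgebra A I ⊗[A] M) :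
    presentationCoeff I M 0 (SymmetricAlgebra.ι A I x • z) = 0 := by
  induction z with
  | zero => simp
  | add z w hz hw => simp only [smul_add, map_add, hz, hw, add_zero]
  | tmul s m =>
    rw [TensorProduct.smul_tmul', smul_eq_mul, presentationCoeff_tmul,
      map_mul, Subalgebra.coe_mul, coe_symToRees_ι, Polynomial.mul_coeff_zero]
    simp

theorem tmul_mem_symTensorDegree {n : ℕ} {s : SymmetricAlgebra A I} (hs : s ∈ symDegree I n)
    (m : M) :
    s ⊗ₜ m ∈ symTensorDegree I M n :=
  ⟨⟨s, hs⟩ ⊗ₜ m, rfl⟩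

theorem ι_smul_mem_symTensorDegree {n : ℕ} (x : I) {z : SymmetricAlgebra A I ⊗[A] M}
    (hz : z ∈ symTensorDegree I M n) :
    SymmetricAlgebra.ι A I x • z ∈ symTensorDegree I M (n + 1) := by
  obtain ⟨t, rfl⟩ := hz
  induction t with
  | zero => simp
  | add z w hz hw => rw [map_add, smul_add]; exact add_mem hz hw
  | tmul s m =>
    rw [TensorProduct.map_tmul, TensorProduct.smul_tmul', smul_eq_mul]
    refine tmul_mem_symTensorDegree ?_ _
    rw [symDegree, pow_succ']
    exact Submodule.mul_mem_mul ⟨x, rfl⟩ s.2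

theorem symTensorDegree_succ (n : ℕ) : symTensorDegree I M (n + 1) = Submodule.span A
    {w | ∃ x : I, ∃ z ∈ symTensorDegree I M n, w = SymmetricAlgebra.ι A I x • z} := by
  apply le_antisymm
  · rintro _ ⟨t, rfl⟩
    induction t with
    | zero => simp
    | add z w hz hw => rw [map_add]; exact add_mem hz hw
    | tmul s m =>
      obtain ⟨s, hs⟩ := s
      rw [TensorProduct.map_tmul]
      change s ⊗ₜ m ∈ _
      rw [symDegree, pow_succ'] at hs
      refine Submodule.mul_induction_on hs ?_ ?_
      · rintro _ ⟨x, rfl⟩ s' hs'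
        exact Submodule.subset_span ⟨x, s' ⊗ₜ m, tmul_mem_symTensorDegree hs' m, by
          rw [TensorProduct.smul_tmul', smul_eq_mul]⟩
      · intro s s' h h'
        rw [TensorProduct.add_tmul]
        exact add_mem h h'
  · rw [Submodule.span_le]
    rintro _ ⟨x, z, hz, rfl⟩
    exact ι_smul_mem_symTensorDegree x hz

theorem presentationCoeff_eq_zero {n j : ℕ} (hj : j ≠ n) {z : SymmetricAlgebra A I ⊗[A] M}
    (hz : z ∈ symTensorDegree I M n) : presentationCoeff I M j z = 0 := by
  induction n generalizing j z with
  | zero =>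
    obtain ⟨t, rfl⟩ := hz
    induction t with
    | zero => simp
    | add z w hz hw => rw [map_add, map_add, hz, hw, add_zero]
    | tmul s m =>
      obtain ⟨s, hs⟩ := s
      rw [symDegree, pow_zero] at hs
      obtain ⟨a, rfl⟩ := Submodule.mem_one.1 hs
      change presentationCoeff I M j (algebraMap _ _ a ⊗ₜ m) = 0
      rw [presentationCoeff_tmul, AlgHom.commutes]
      change (Polynomial.C a).coeff j • m = 0
      rw [Polynomial.coeff_C, if_neg hj, zero_smul]
  | succ n ih =>
    rw [symTensorDegree_succ] at hz
    induction hz using Submodule.span_induction with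
    | mem w hw =>
      obtain ⟨x, z, hz, rfl⟩ := hw
      cases j with
      | zero => exact presentationCoeff_zero_ι_smul x z
      | succ j => rw [presentationCoeff_succ_ι_smul, ih (by omega) hz, smul_zero]
    | zero => simp
    | add z w _ _ hz hw => rw [map_add, hz, hw, add_zero]
    | smul a z _ hz => rw [map_smul, hz, smul_zero]

/-- A homogeneous element of degree `n` has image concentrated in degree `n`, so a single
coefficient decides membership in the kernel. -/
theorem mem_relations_iff {n : ℕ} {z : SymmetricAlgebra A I ⊗[A] M} : z ∈ relations I M n ↔
    z ∈ symTensorDegree I M n ∧ presentationCoeff I M n z = 0 := by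
  refine and_congr_right fun hz => ?_
  rw [SetLike.mem_coe, LinearMap.mem_ker, ← Submodule.coe_eq_zero, ← PolynomialModule.coeff_eq_zero,
    Finsupp.ext_iff]
  refine ⟨fun h => h n, fun h j => ?_⟩
  by_cases hj : j = n
  · rw [hj]; exact h
  · exact presentationCoeff_eq_zero hj hz

variable (I M) in
theorem map_presentationCoeff_symTensorDegree (n : ℕ) :
    (symTensorDegree I M n).map (presentationCoeff I M n) = I ^ n • ⊤ := by
  apply le_antisymm
  · rintro _ ⟨z, -, rfl⟩
    exact (symPresentation I M z).2 n
  · induction n with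
    | zero =>
      intro m _
      refine ⟨1 ⊗ₜ m, tmul_mem_symTensorDegree (by simp [symDegree]) m, ?_⟩
      rw [presentationCoeff_tmul, map_one]
      simp
    | succ n ih =>
      rw [pow_succ', mul_smul, Submodule.smul_le]
      intro x hx m hm
      obtain ⟨z, hz, rfl⟩ := ih hm
      exact ⟨_, ι_smul_mem_symTensorDegree ⟨x, hx⟩ hz, presentationCoeff_succ_ι_smul n ⟨x, hx⟩ z⟩

end RelationType

namespace RelationType

universe u v

variable {A : Type u} [CommRing A] {I : Ideal A} {M : Type v} [AddCommGroup M] [Module A M]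

noncomputable instance (n : ℕ) : AddCommGroup (symTensorDegree I M n) := Submodule.addCommGroup _

theorem exists_baseChange_presentationCoeff_eq {B : Type*} [CommRing B] [Algebra A B] {y : B}
    {p : ℕ}
    (hy : (I.map (algebraMap A B)) ^ (p + 1) =
      Ideal.span {y} * (I.map (algebraMap A B)) ^ p) {m : M} (hm : m ∈ I ^ (p + 1) •
    (⊤ : Submodule A M)) :
    ∃ u : B ⊗[A] symTensorDegree I M p, (1 : B) ⊗ₜ[A] m =
      y • (presentationCoeff I M p ∘ₗ (symTensorDegree I M p).subtype).baseChange B u := by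
  suffices h : ∃ w ∈ LinearMap.range
      ((presentationCoeff I M p ∘ₗ (symTensorDegree I M p).subtype).baseChange B),
      (1 : B) ⊗ₜ[A] m = y • w by
    obtain ⟨_, ⟨u, rfl⟩, hu⟩ := h
    exact ⟨u, hu⟩
  set W := LinearMap.range
    ((presentationCoeff I M p ∘ₗ (symTensorDegree I M p).subtype).baseChange B)
  have hW (c : B) (hc : c ∈ (I.map (algebraMap A B)) ^ p) (m : M) : c ⊗ₜ[A] m ∈ W := by
    rw [← Ideal.map_pow] at hc
    induction hc using Submodule.span_induction with
    | mem c hc =>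
      obtain ⟨a, ha, rfl⟩ := hc
      have h1 : a • m ∈ (symTensorDegree I M p).map (presentationCoeff I M p) := by
        rw [map_presentationCoeff_symTensorDegree]
        exact Submodule.smul_mem_smul ha trivial
      obtain ⟨z, hz, hzm⟩ := h1
      refine ⟨1 ⊗ₜ ⟨z, hz⟩, ?_⟩
      rw [LinearMap.baseChange_tmul, LinearMap.comp_apply, Submodule.subtype_apply, hzm,
        ← TensorProduct.smul_tmul, Algebra.algebraMap_eq_smul_one]
    | zero => simp
    | add c d _ _ hc hd => rw [TensorProduct.add_tmul]; exact add_mem hc hd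
    | smul b c _ hc =>
      rw [← TensorProduct.smul_tmul']
      exact W.smul_mem b hc
  refine Submodule.smul_induction_on hm (fun a ha m _ => ?_) ?_
  · have h1 : algebraMap A B a ∈ (I.map (algebraMap A B)) ^ (p + 1) := by
      rw [← Ideal.map_pow]
      exact Ideal.mem_map_of_mem _ ha
    rw [hy, Ideal.mem_span_singleton_mul] at h1
    obtain ⟨c, hc, hca⟩ := h1
    refine ⟨_, hW c hc m, ?_⟩
    rw [TensorProduct.smul_tmul', smul_eq_mul, hca, Algebra.algebraMap_eq_smul_one,
      TensorProduct.smul_tmul]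
  · rintro m m' ⟨w, hw, h⟩ ⟨w', hw', h'⟩
    exact ⟨w + w', add_mem hw hw', by rw [TensorProduct.tmul_add, h, h', smul_add]⟩

/-- If `I` contains an `M`-regular element and `Iᵖ⁺¹ = y Iᵖ` for some `y ∈ I` after a faithfully
flat base change, then there are no effective relations in degree `p + 2`. -/
theorem relations_le_inducedRelations {B : Type*} [CommRing B] [Algebra A B]
    [Module.FaithfullyFlat A B] {y : B} (hyI : y ∈ I.map (algebraMap A B)) {p : ℕ}
    (hy : (I.map (algebraMap A B)) ^ (p + 1) = Ideal.span {y} * (I.map (algebraMap A B)) ^ p)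
    {x₀ : A} (hx₀ : x₀ ∈ I) (hreg : IsSMulRegular M x₀) :
    relations I M (p + 2) ≤ inducedRelations I M (p + 2) := by
  let S := SymmetricAlgebra A I ⊗[A] M
  let mulι (x : I) : S →ₗ[A] S := DistribSMul.toLinearMap A S (SymmetricAlgebra.ι A I x)
  let K : Submodule A (symTensorDegree I M (p + 1)) :=
    LinearMap.ker (presentationCoeff I M (p + 1) ∘ₗ (symTensorDegree I M (p + 1)).subtype)
  let Q := inducedRelations I M (p + 2)
  let act (x : I) : symTensorDegree I M p →ₗ[A] symTensorDegree I M (p + 1) ⧸ K :=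
    K.mkQ ∘ₗ (mulι x).restrict fun _ hz => ι_smul_mem_symTensorDegree x hz
  let j₁ : (symTensorDegree I M (p + 1) ⧸ K) →ₗ[A] M := K.liftQ _ le_rfl
  -- Multiplication by `x` descends to the quotient by `K` because it sends relations of degree `p +
  -- 1` to induced ones.
  let θ (x : I) : (symTensorDegree I M (p + 1) ⧸ K) →ₗ[A] S ⧸ Q :=
    K.liftQ (Q.mkQ ∘ₗ mulι x ∘ₗ (symTensorDegree I M (p + 1)).subtype) fun w hw => by
      refine (Submodule.Quotient.mk_eq_zero _).2 ?_
      exact Submodule.subset_span ⟨x, w, mem_relations_iff.2 ⟨w.2, hw⟩, rfl⟩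
  have hj₁ (w : symTensorDegree I M (p + 1)) :
      j₁ (K.mkQ w) = presentationCoeff I M (p + 1) (w : S) := Submodule.liftQ_apply _ _ _
  have hact (x : I) (u : symTensorDegree I M p) :
      j₁ (act x u) = (x : A) • presentationCoeff I M p (u : S) := by
    rw [← presentationCoeff_succ_ι_smul]
    exact hj₁ _
  -- `y` divides the image of `x₀ ^ (p + 1)`, which stays regular on `B ⊗ M` by flatness.
  have hregB (v : B ⊗[A] M) (hv : y • v = 0) : v = 0 := by
    have h1 : algebraMap A B (x₀ ^ (p + 1)) ∈ (I.map (algebraMap A B)) ^ (p + 1) := by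
      rw [← Ideal.map_pow]
      exact Ideal.mem_map_of_mem _ (Ideal.pow_mem_pow hx₀ _)
    rw [hy, Ideal.mem_span_singleton_mul] at h1
    obtain ⟨c, -, hc⟩ := h1
    have h2 : IsSMulRegular (B ⊗[A] M) (x₀ ^ (p + 1)) := IsSMulRegular.lTensor B (hreg.pow _)
    refine h2 ?_
    change x₀ ^ (p + 1) • v = x₀ ^ (p + 1) • (0 : B ⊗[A] M)
    rw [smul_zero, ← algebraMap_smul B, ← hc, mul_comm, mul_smul, hv, smul_zero]
  intro z hz
  obtain ⟨hzd, hz0⟩ := mem_relations_iff.1 hz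
  rw [symTensorDegree_succ] at hzd
  obtain ⟨d, c, f, hf⟩ := Submodule.mem_span_set'.1 hzd
  choose x w hw hxw using fun k => (f k).2
  have hzsum : z = ∑ k, SymmetricAlgebra.ι A I (c k • x k) • w k := by
    rw [← hf]
    refine Finset.sum_congr rfl fun k _ => ?_
    rw [hxw, map_smul, smul_assoc]
  have key := sum_eq_zero_of_faithfullyFlat (B := B) act
    (presentationCoeff I M p ∘ₗ (symTensorDegree I M p).subtype) j₁
    (LinearMap.ker_eq_bot.1 (Submodule.ker_liftQ_eq_bot _ _ _ le_rfl))
    hact θ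
    (fun x x' u => congrArg Q.mkQ (smul_comm (SymmetricAlgebra.ι A I x)
      (SymmetricAlgebra.ι A I x') (u : S))) hyI hregB
    (fun g => by
      obtain ⟨g, rfl⟩ := K.mkQ_surjective g
      refine exists_baseChange_presentationCoeff_eq hy ?_
      rw [← map_presentationCoeff_symTensorDegree]
      exact ⟨g, g.2, rfl⟩)
    (fun k => c k • x k) (fun k => K.mkQ ⟨w k, hw k⟩) (by
      rw [hzsum, map_sum] at hz0
      simpa only [hj₁, presentationCoeff_succ_ι_smul] using hz0)
  rw [← Submodule.Quotient.mk_eq_zero, ← Submodule.mkQ_apply, hzsum, map_sum]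
  exact key

theorem relationType_le_of_map_pow_succ_eq {B : Type*} [CommRing B] [Algebra A B]
    [Module.FaithfullyFlat A B] {y : B} (hyI : y ∈ I.map (algebraMap A B)) {r : ℕ}
    (hy : (I.map (algebraMap A B)) ^ (r + 1) = Ideal.span {y} * (I.map (algebraMap A B)) ^ r)
    {x₀ : A} (hx₀ : x₀ ∈ I) (hreg : IsSMulRegular M x₀) :
    relationType I M ≤ (r + 1 : ℕ) := by
  refine sInf_le ⟨by exact_mod_cast Nat.le_add_left 1 r, fun n hn => ?_⟩
  have hn' : r + 1 < n := by exact_mod_cast hn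
  -- Effective relations vanish in degree `p + 2` once `p ≥ r`, which covers exactly the degrees
  -- above `r + 1`.
  obtain ⟨k, rfl⟩ : ∃ k, n = (r + k) + 2 := ⟨n - (r + 2), by omega⟩
  have hk : (I.map (algebraMap A B)) ^ (r + k + 1) =
      Ideal.span {y} * (I.map (algebraMap A B)) ^ (r + k) := by
    rw [show r + k + 1 = (r + 1) + k by ring, pow_add, hy, pow_add, mul_assoc]
  rw [Submodule.Quotient.subsingleton_iff, Submodule.submoduleOf_eq_top]
  exact relations_le_inducedRelations hyI hk hx₀ hreg

end RelationType

theorem exists_isSMulRegular_of_localDepth_eq_one {A : Type*} [CommRing A] [IsLocalRing A]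
    {M : Type*}
    [AddCommGroup M] [Module A M] (h : localDepth A M = 1) :
    ∃ x ∈ IsLocalRing.maximalIdeal A, IsSMulRegular M x := by
  obtain ⟨⟨rs, hmem, hreg⟩, hpos⟩ := lt_iSup_iff.1 (show (0 : ℕ∞) < localDepth A M by simp [h])
  cases rs with
  | nil => simp at hpos
  | cons x rs =>
    exact ⟨x, hmem x (by simp), ((RingTheory.Sequence.isRegular_cons_iff M x rs).1 hreg).1⟩

theorem IsCohenMacaulayModule.exists_isSMulRegular {A : Type*} [CommRing A] [IsLocalRing A]
    {M : Type*}
    [AddCommGroup M] [Module A M] (hM : IsCohenMacaulayModule A M)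
    (hdim : Module.supportDim A M = 1) :
    ∃ x ∈ IsLocalRing.maximalIdeal A, IsSMulRegular M x := by
  obtain ⟨-, hs | h⟩ := hM
  · rw [Module.supportDim_eq_bot_of_subsingleton] at hdim
    exact absurd hdim (by decide)
  · rw [hdim] at h
    exact exists_isSMulRegular_of_localDepth_eq_one (by exact_mod_cast h)

theorem mainTheorem5 {A : Type*} [CommRing A] [IsLocalRing A]
    (hA : IsCohenMacaulayLocalRing A) (hdim : ringKrullDim A = 1)
    (M : Type*) [AddCommGroup M] [Module A M] (hM : IsMaximalCohenMacaulayModule A M)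
    (I : Ideal A) (hI : I.IsPrimary) (hIm : I.radical = IsLocalRing.maximalIdeal A) :
    ((relationType I M : ℕ∞) : ENNReal) ≤ localMultiplicity A := by
  have := hA.1
  have : Ring.KrullDimLE 1 A := (Order.krullDimLE_iff 1 _).2 hdim.le
  obtain ⟨x, hxm, hx⟩ := hA.2.exists_isSMulRegular
    (by rw [Module.supportDim_self_eq_ringKrullDim, hdim])
  -- Two regular elements are used: `x`, regular on `A`, for the length estimates, and `x₀`, regular
  -- on `M`, for cancelling `y`.
  obtain ⟨x₀, hx₀m, hx₀⟩ := hM.1.exists_isSMulRegular (hM.2.trans hdim)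
  rw [← hIm] at hx₀m
  obtain ⟨n₀, hn₀⟩ := hx₀m
  have hx' : x ∈ nonZeroDivisors A := mem_nonZeroDivisors_iff_right.2 fun z hz =>
    hx (by simpa [mul_comm] using hz)
  obtain ⟨r, hr, hred⟩ := exists_reductionNumber_lt_multiplicity A hx' hxm
  rw [← hIm] at hxm
  obtain ⟨n, hn⟩ := hxm
  obtain ⟨y, hyI, hy⟩ := hred (I.map (algebraMap A (GenericExtension A)))
    (Ideal.FG.map (IsNoetherian.noetherian I) _) n
    (by rw [← map_pow]; exact Ideal.mem_map_of_mem _ hn)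
  have hle := RelationType.relationType_le_of_map_pow_succ_eq (M := M) hyI hy hn₀ (hx₀.pow n₀)
  have hnat : natKrullDim A = 1 := by
    rw [natKrullDim, hdim]
    rfl
  rw [localMultiplicity, hnat]
  refine le_trans ?_ hr
  exact_mod_cast hle
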